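/- Let $N, N'$ be integers with $2\le N'<N$, and let $M\subset\mathbb{C}^N$ and $M'\subset\mathbb{C}^{N'}$ be smooth ($C^\infty$, embedded) strongly pseudoconvex real hypersurfaces, with $M$ connected. Here strongly pseudoconvex means that every point $p$ of the hypersurface has a neighbourhood $U$ with a smooth real-valued function $\rho$ on $U$ such that, within $U$, the hypersurface is $\{\rho=0\}$, $d\rho\neq0$ at its points, and $$\sum_{j,k}\frac{\partial^2\rho}{\partial z_j\,\partial\bar z_k}(p)\,w_j\bar w_k>0\quad\text{for all } w\neq0 \text{ with } \sum_j\frac{\partial\rho}{\partial z_j}(p)\,w_j=0 .$$ Let $F:M\to M'$ be a CR mapping of class $C^2$, that is, a $C^2$ map whose (complexified) differential satisfies $dF(\mathcal V_p)\subset\mathcal V'_{F(p)}$ for every $p\in M$, where $\mathcal V=T^{0,1}M$ and $\mathcal V'=T^{0,1}M'$ are the CR bundles, i.e. the bundles of the complexified tangent vectors of $M$ and $M'$ that are of type $(0,1)$ in $\mathbb{C}^N$ and $\mathbb{C}^{N'}$. Then $F$ is a constant map. -/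

import Mathlib

open scoped ContDiff TensorProduct

noncomputable section

/-- `ρ` is a smooth defining function of `M ⊆ ℂ^N` in the open set `U`: inside `U` the set `M` is
the zero set of the smooth real function `ρ`, and `dρ` does not vanish at the points of `M`. -/
structure IsDefiningFunctionOn {N : ℕ} (M U : Set (Fin N → ℂ)) (ρ : (Fin N → ℂ) → ℝ) : Prop where
  isOpen : IsOpen U
  contDiffOn : ContDiffOn ℝ ∞ ρ U
  mem_iff : ∀ z ∈ U, z ∈ M ↔ ρ z = 0
  fderiv_ne_zero : ∀ z ∈ U, z ∈ M → fderiv ℝ ρ z ≠ 0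

/-- `M` is a smooth (embedded) real hypersurface of `ℂ^N`. -/
def IsSmoothRealHypersurface {N : ℕ} (M : Set (Fin N → ℂ)) : Prop :=
  ∀ p ∈ M, ∃ U ρ, p ∈ U ∧ IsDefiningFunctionOn M U ρ

/-- The Wirtinger derivative `∂f/∂z_j = (∂f/∂x_j - i ∂f/∂y_j) / 2`. -/
def wirtingerDeriv {N : ℕ} (j : Fin N) (f : (Fin N → ℂ) → ℂ) (z : Fin N → ℂ) : ℂ :=
  (fderiv ℝ f z (Pi.single j 1) - Complex.I * fderiv ℝ f z (Pi.single j Complex.I)) / 2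

/-- The conjugate Wirtinger derivative `∂f/∂z̄_j = (∂f/∂x_j + i ∂f/∂y_j) / 2`. -/
def wirtingerDerivBar {N : ℕ} (j : Fin N) (f : (Fin N → ℂ) → ℂ) (z : Fin N → ℂ) : ℂ :=
  (fderiv ℝ f z (Pi.single j 1) + Complex.I * fderiv ℝ f z (Pi.single j Complex.I)) / 2

/-- The Levi form `∑ ∂²ρ/∂z_j∂z̄_k (p) w_j w̄_k` of `ρ` at `p` in the direction `w`. The sum is
real when `ρ` is of class `C^2` near `p`. -/
def leviForm {N : ℕ} (ρ : (Fin N → ℂ) → ℝ) (p w : Fin N → ℂ) : ℝ :=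
  (∑ j, ∑ k, wirtingerDeriv j (wirtingerDerivBar k fun z => (ρ z : ℂ)) p
    * w j * (starRingEnd ℂ) (w k)).re

/-- `M` is a smooth strongly pseudoconvex real hypersurface of `ℂ^N`: near each of its points it
has a smooth defining function (its sign being chosen suitably) whose Levi form at that point is
positive definite on the holomorphic tangent vectors `w`, those with `∑ ∂ρ/∂z_j (p) w_j = 0`. -/
def IsStronglyPseudoconvexHypersurface {N : ℕ} (M : Set (Fin N → ℂ)) : Prop :=
  IsSmoothRealHypersurface M ∧
  ∀ p ∈ M, ∃ U ρ, p ∈ U ∧ IsDefiningFunctionOn M U ρ ∧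
    ∀ w : Fin N → ℂ, w ≠ 0 → ∑ j, wirtingerDeriv j (fun z => (ρ z : ℂ)) p * w j = 0 →
      0 < leviForm ρ p w

/-- The real tangent space `T_p M` of a hypersurface `M` of `ℂ^N`: the vectors annihilated by the
differentials at `p` of the defining functions of `M` near `p`. (The kernel of `dρ_p` is the same
for all of them.) -/
def realTangentSpace {N : ℕ} (M : Set (Fin N → ℂ)) (p : Fin N → ℂ) : Submodule ℝ (Fin N → ℂ) where
  carrier := {v | ∀ U ρ, p ∈ U → IsDefiningFunctionOn M U ρ → fderiv ℝ ρ p v = 0}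
  add_mem' {a b} ha hb U ρ hp hρ := by simp [ha U ρ hp hρ, hb U ρ hp hρ]
  zero_mem' U ρ _ _ := by simp
  smul_mem' c a ha U ρ hp hρ := by simp [ha U ρ hp hρ]

/-- The complex structure `J` of `ℂ^N`: multiplication by `i`, as a real linear map. -/
def complexStructure (N : ℕ) : (Fin N → ℂ) →ₗ[ℝ] (Fin N → ℂ) where
  toFun v := Complex.I • v
  map_add' := smul_add Complex.I
  map_smul' c v := smul_comm Complex.I c v

/-- The fibre at `p` of the CR bundle `𝒱 = T^{0,1} M` of a hypersurface `M` of `ℂ^N`: the vectors of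
the complexified tangent space `ℂ ⊗ T_p M ⊆ ℂ ⊗ T_p ℂ^N` which are of type `(0,1)`, that is, on
which the complexification of `J` acts as multiplication by `-i`. -/
def crBundle {N : ℕ} (M : Set (Fin N → ℂ)) (p : Fin N → ℂ) : Submodule ℂ (ℂ ⊗[ℝ] (Fin N → ℂ)) :=
  (realTangentSpace M p).baseChange ℂ ⊓
    Module.End.eigenspace ((complexStructure N).baseChange ℂ) (-Complex.I)

/-- `F : M → M'` is a CR map of class `C^k` (`k ≥ 1`) between hypersurfaces of `ℂ^N` and `ℂ^{N'}`.
Near each `p` in `M` it is the restriction of a `C^k` map `Φ` from an open subset of `ℂ^N` to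
`ℂ^{N'}`, and its differential satisfies `dF(𝒱_p) ⊆ 𝒱'_{F(p)}`. Since `𝒱_p ⊆ ℂ ⊗ T_p M`,
where `dΦ` agrees with `dF`, this does not depend on `Φ`. -/
def IsCRMapOfClass {N N' : ℕ} (k : ℕ) {M : Set (Fin N → ℂ)} {M' : Set (Fin N' → ℂ)}
    (F : M → M') : Prop :=
  ∀ p : M, ∃ (U : Set (Fin N → ℂ)) (Φ : (Fin N → ℂ) → (Fin N' → ℂ)),
    IsOpen U ∧ (p : Fin N → ℂ) ∈ U ∧ ContDiffOn ℝ k Φ U ∧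
    (∀ q : M, (q : Fin N → ℂ) ∈ U → Φ q = F q) ∧
    (crBundle M p).map ((fderiv ℝ Φ p).toLinearMap.baseChange ℂ) ≤ crBundle M' (F p)

end

open Filter Topology

/-! Pull the contact form dρ' ∘ J of M' back by a local extension Φ of F. The CR condition makes the
pullback vanish on the complex tangent spaces of M, so along M it is μ dρ ∘ J + ν dρ. Comparing
exterior derivatives on a pair (w, Jw) gives Levi'(dΦ w) = μ Levi(w)
(`exists_multiplier_of_vanishing_on_complex_tangent`). Since N' < N, dΦ kills some nonzero complex
tangent w, and positivity of Levi(w) forces μ = 0. Positivity of Levi' then gives dΦ = 0 on the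
whole complex tangent space.

The remaining real direction uses the same lemma on the components of dΦ: these forms are closed and
vanish on complex tangents, so their multiplier of dρ ∘ J times Levi is zero. Hence they are
multiples of dρ and vanish on the tangent space of M. So F is locally constant
(`eventually_eq_of_fderiv_eq_zero_on_level`), and M is connected. -/

theorem HasFDerivAt.clm_apply_const {E F G : Type*} [NormedAddCommGroup E] [NormedSpace ℝ E]
    [NormedAddCommGroup F] [NormedSpace ℝ F] [NormedAddCommGroup G] [NormedSpace ℝ G]
    {c : E → G →L[ℝ] F} {c' : E →L[ℝ] G →L[ℝ] F} {p : E} (hc : HasFDerivAt c c' p) (v : G) :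
    HasFDerivAt (fun q => c q v) (c'.flip v) p := by
  simpa using hc.clm_apply (hasFDerivAt_const v p)

/-! ### Calculus on regular level sets. -/

section LevelSets

variable {E F : Type*} [NormedAddCommGroup E] [NormedSpace ℝ E] [CompleteSpace E]
  [NormedAddCommGroup F] [NormedSpace ℝ F]

/-- If `g` vanishes on the regular level set `{ρ = 0}` near `p`, then its differential at `p`
vanishes on the tangent space of the level set. -/
theorem HasStrictFDerivAt.apply_eq_zero_of_eq_zero_on_level {ρ : E → ℝ} {g : E → F} {p : E}
    {ρ' : E →L[ℝ] ℝ} {g' : E →L[ℝ] F} (hρ : HasStrictFDerivAt ρ ρ' p)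
    (hg : HasStrictFDerivAt g g' p) (hρ' : ρ' ≠ 0) (hp : ρ p = 0)
    (h : ∀ᶠ q in 𝓝 p, ρ q = 0 → g q = 0) {v : E} (hv : ρ' v = 0) : g' v = 0 := by
  refine SeparatingDual.eq_zero_of_forall_dual_eq_zero (R := ℝ) fun l => ?_
  have hl : HasStrictFDerivAt (fun q => l (g q)) (l.comp g') p :=
    l.hasStrictFDerivAt.comp p hg
  -- A function vanishing on the level set is trivially extremal there, so Lagrange multipliers
  -- apply; `ρ' ≠ 0` makes the multiplier of `l ∘ g'` nonzero.
  have hext : IsLocalExtrOn (fun q => l (g q)) {q | ρ q = ρ p} p := by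
    left
    refine eventually_nhdsWithin_iff.2 (h.mono fun q hq hqp => ?_)
    have hq' : ρ q = 0 := by rw [← hp]; exact hqp
    simp [hq hq', h.self_of_nhds hp]
  obtain ⟨a, b, hab, hsum⟩ := hext.exists_multipliers_of_hasStrictFDerivAt_1d hρ hl
  have hb : b ≠ 0 := by
    rintro rfl
    have ha : a ≠ 0 := by rintro rfl; exact hab rfl
    simp only [zero_smul, add_zero, smul_eq_zero] at hsum
    exact hsum.elim ha hρ'
  have := DFunLike.congr_fun hsum v
  simpa [hv, hb] using this

/-- A map whose differential vanishes on the tangent spaces of the regular level set `{ρ = 0}` is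
locally constant on it. -/
theorem eventually_eq_of_fderiv_eq_zero_on_level {ρ : E → ℝ} {Φ : E → F} {p : E}
    (hρ : ContDiffAt ℝ 1 ρ p) (hΦ : ContDiffAt ℝ 1 Φ p) (hρ' : fderiv ℝ ρ p ≠ 0) (hp : ρ p = 0)
    (h : ∀ᶠ q in 𝓝 p, ρ q = 0 → ∀ v, fderiv ℝ ρ q v = 0 → fderiv ℝ Φ q v = 0) :
    ∀ᶠ q in 𝓝 p, ρ q = 0 → Φ q = Φ p := by
  set l := fderiv ℝ ρ p with hl
  obtain ⟨n, hn⟩ : ∃ n, l n = 1 := by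
    obtain ⟨m, hm⟩ : ∃ m, l m ≠ 0 := by
      by_contra! hcon
      exact hρ' (ContinuousLinearMap.ext hcon)
    exact ⟨(l m)⁻¹ • m, by simp [hm]⟩
  -- the chart `f` straightens the level set `{ρ = 0}` to the hyperplane `{l = 0}`
  let f : E → E := fun x => x + (ρ x - l x) • n
  have hfc : ContDiffAt ℝ 1 f p :=
    contDiffAt_id.add ((hρ.sub l.contDiff.contDiffAt).smul contDiffAt_const)
  have hρd : HasFDerivAt ρ l p := (hρ.differentiableAt one_ne_zero).hasFDerivAt
  have hfd : HasFDerivAt f ((ContinuousLinearEquiv.refl ℝ E : E ≃L[ℝ] E) : E →L[ℝ] E) p := by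
    have := (hasFDerivAt_id p).add ((hρd.sub l.hasFDerivAt).smul_const n)
    refine this.congr_fderiv ?_
    ext; simp
  have hlf : ∀ x, l (f x) = ρ x := fun x => by simp [f, hn]
  let ψ := hfc.localInverse hfd one_ne_zero
  have hψc : ContDiffAt ℝ 1 ψ (f p) := hfc.to_localInverse hfd one_ne_zero
  have hψp : ψ (f p) = p := hfc.localInverse_apply_image hfd one_ne_zero
  have hs := hfc.hasStrictFDerivAt' hfd one_ne_zero
  have hleft : ∀ᶠ x in 𝓝 p, ψ (f x) = x := hs.eventually_left_inverse
  have hright : ∀ᶠ y in 𝓝 (f p), f (ψ y) = y := hs.eventually_right_inverse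
  have hψd : ∀ᶠ y in 𝓝 (f p), DifferentiableAt ℝ ψ y :=
    (hψc.eventually (by simp)).mono fun y hy => hy.differentiableAt one_ne_zero
  have hψt : Tendsto ψ (𝓝 (f p)) (𝓝 p) := by
    have := hψc.continuousAt.tendsto
    rwa [hψp] at this
  have hρe : ∀ᶠ x in 𝓝 p, DifferentiableAt ℝ ρ x :=
    (hρ.eventually (by simp)).mono fun y hy => hy.differentiableAt one_ne_zero
  have hΦe : ∀ᶠ x in 𝓝 p, DifferentiableAt ℝ Φ x :=
    (hΦ.eventually (by simp)).mono fun y hy => hy.differentiableAt one_ne_zero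
  -- the projection to the hyperplane along `n`
  let π : E →L[ℝ] E := ContinuousLinearMap.id ℝ E - l.smulRight n
  have hlπ : ∀ x, l (π x) = 0 := fun x => by simp [π, hn]
  have hπ : ∀ x, l x = 0 → π x = x := fun x hx => by simp [π, hx]
  have hfp : π (f p) = f p := hπ _ (by rw [hlf, hp])
  have hπt : Tendsto π (𝓝 (f p)) (𝓝 (f p)) := by
    have := π.continuous.tendsto (f p)
    rwa [hfp] at this
  -- Precomposing with `π` keeps `ψ (π y)` on the level set, so its velocities are tangent to it.
  -- Constancy can then be tested on a full ball of `E`.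
  have hall : ∀ᶠ y in 𝓝 (f p), HasFDerivAt (fun y => Φ (ψ (π y))) (0 : E →L[ℝ] F) y := by
    filter_upwards [hπt.eventually hψd, hπt.eventually hright.eventually_nhds,
      hπt.eventually (hψt.eventually hρe), hπt.eventually (hψt.eventually hΦe),
      hπt.eventually (hψt.eventually h)] with y h1 h2 h3 h4 h5
    have hz : ρ (ψ (π y)) = 0 := by rw [← hlf, h2.self_of_nhds, hlπ]
    have hcomp : HasFDerivAt (fun y => Φ (ψ (π y)))
        ((fderiv ℝ Φ (ψ (π y))).comp ((fderiv ℝ ψ (π y)).comp π)) y :=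
      h4.hasFDerivAt.comp y (h1.hasFDerivAt.comp y π.hasFDerivAt)
    refine hcomp.congr_fderiv (ContinuousLinearMap.ext fun w => h5 hz _ ?_)
    have hρψ : HasFDerivAt (fun y => ρ (ψ y)) ((fderiv ℝ ρ (ψ (π y))).comp (fderiv ℝ ψ (π y)))
        (π y) := h3.hasFDerivAt.comp (π y) h1.hasFDerivAt
    have hlin : HasFDerivAt (fun y => ρ (ψ y)) l (π y) := by
      refine l.hasFDerivAt.congr_of_eventuallyEq (h2.mono fun z hz => ?_)
      change ρ (ψ z) = l z
      rw [← hlf, hz]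
    have := DFunLike.congr_fun (hρψ.unique hlin) (π w)
    simpa [hlπ] using this
  obtain ⟨r, hr, hball⟩ := Metric.eventually_nhds_iff_ball.1 hall
  have hconst : ∀ y ∈ Metric.ball (f p) r, Φ (ψ (π y)) = Φ (ψ (π (f p))) := fun y hy =>
    Metric.isOpen_ball.is_const_of_fderiv_eq_zero (𝕜 := ℝ) (f := fun y => Φ (ψ (π y)))
      (convex_ball (f p) r).isPreconnected
      (fun z hz => (hball z hz).differentiableAt.differentiableWithinAt)
      (fun z hz => (hball z hz).fderiv) hy (Metric.mem_ball_self hr)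
  filter_upwards [hleft, hfc.continuousAt.eventually (Metric.ball_mem_nhds (f p) hr)]
    with x hx hxr hx0
  have := hconst (f x) hxr
  rwa [hfp, hψp, hπ (f x) (by rw [hlf, hx0]), hx] at this

/-- Let `α` be a `C^1` field of real covectors near a point `p` of the regular level set `{ρ = 0}`,
in a space with complex structure `J`, which vanishes on the complex tangent spaces of the level
set. Then `α = μ dρ ∘ J + ν dρ` at `p`, and the exterior derivative of `α` is, on the complex
tangent space at `p`, given by `-μ` times the Levi form of `ρ`. -/
theorem exists_multiplier_of_vanishing_on_complex_tangent {J : E →L[ℝ] E}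
    (hJ : ∀ v, J (J v) = -v) {ρ : E → ℝ} {α : E → E →L[ℝ] ℝ} {p : E} (hρ : ContDiffAt ℝ 2 ρ p)
    (hα : ContDiffAt ℝ 1 α p) (hρ' : fderiv ℝ ρ p ≠ 0) (hp : ρ p = 0)
    (h : ∀ᶠ q in 𝓝 p, ρ q = 0 → ∀ v, fderiv ℝ ρ q v = 0 → fderiv ℝ ρ q (J v) = 0 → α q v = 0) :
    ∃ μ ν : ℝ, (∀ v, α p v = μ * fderiv ℝ ρ p (J v) + ν * fderiv ℝ ρ p v) ∧
      ∀ w, fderiv ℝ ρ p w = 0 → fderiv ℝ ρ p (J w) = 0 →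
        fderiv ℝ α p w (J w) - fderiv ℝ α p (J w) w =
          -μ * (fderiv ℝ (fderiv ℝ ρ) p w w + fderiv ℝ (fderiv ℝ ρ) p (J w) (J w)) := by
  obtain ⟨n, hn⟩ : ∃ m, fderiv ℝ ρ p m ≠ 0 := by
    by_contra! hcon
    exact hρ' (ContinuousLinearMap.ext hcon)
  have hdρ : ContDiffAt ℝ 1 (fderiv ℝ ρ) p := hρ.fderiv_right (by norm_num)
  have hev : ∀ {c : E → E →L[ℝ] ℝ} (v : E), ContDiffAt ℝ 1 c p →
      ContDiffAt ℝ 1 (fun q => c q v) p := fun v hc => hc.clm_apply contDiffAt_const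
  -- The coefficients come from splitting a vector along n, Jn and the complex tangent space. `A`
  -- is, up to sign, the determinant of that 2×2 system, kept as a factor to avoid division.
  let a : E → ℝ := fun q => fderiv ℝ ρ q n
  let b : E → ℝ := fun q => fderiv ℝ ρ q (J n)
  let A : E → ℝ := fun q => a q * a q + b q * b q
  let B : E → ℝ := fun q => a q * α q n + b q * α q (J n)
  let C : E → ℝ := fun q => b q * α q n - a q * α q (J n)
  have ha : ContDiffAt ℝ 1 a p := hev n hdρ
  have hb : ContDiffAt ℝ 1 b p := hev (J n) hdρ
  have hA : ContDiffAt ℝ 1 A p := (ha.mul ha).add (hb.mul hb)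
  have hB : ContDiffAt ℝ 1 B p := (ha.mul (hev n hα)).add (hb.mul (hev (J n) hα))
  have hC : ContDiffAt ℝ 1 C p := (hb.mul (hev n hα)).sub (ha.mul (hev (J n) hα))
  have hAp : A p ≠ 0 := by
    have : 0 < a p * a p := mul_self_pos.2 hn
    have := mul_self_nonneg (b p)
    simp only [A]; linarith
  have hrel : ∀ᶠ q in 𝓝 p, ρ q = 0 → ∀ v,
      A q * α q v - B q * fderiv ℝ ρ q v - C q * fderiv ℝ ρ q (J v) = 0 := by
    filter_upwards [h] with q hq hq0 v
    -- This vector is `A q` times the projection of `v` to the complex tangent space along n and Jn.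
    have key := hq hq0 (A q • v - (a q * fderiv ℝ ρ q v + b q * fderiv ℝ ρ q (J v)) • n
      - (b q * fderiv ℝ ρ q v - a q * fderiv ℝ ρ q (J v)) • J n)
      (by simp only [map_sub, map_smul, smul_eq_mul, A, a, b]; ring)
      (by simp only [map_sub, map_smul, smul_eq_mul, A, a, b, hJ, map_neg]; ring)
    simp only [map_sub, map_smul, smul_eq_mul] at key
    simp only [B, C]
    linarith
  refine ⟨C p / A p, B p / A p, fun v => ?_, fun w hw hJw => ?_⟩
  · have := hrel.self_of_nhds hp v
    field_simp
    linarith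
  have hd : ∀ {c : E → ℝ}, ContDiffAt ℝ 1 c p → HasFDerivAt c (fderiv ℝ c p) p :=
    fun hc => (hc.differentiableAt one_ne_zero).hasFDerivAt
  have hdα : HasFDerivAt α (fderiv ℝ α p) p := (hα.differentiableAt one_ne_zero).hasFDerivAt
  have hddρ : HasFDerivAt (fderiv ℝ ρ) (fderiv ℝ (fderiv ℝ ρ) p) p :=
    (hdρ.differentiableAt one_ne_zero).hasFDerivAt
  have hα0 : ∀ v, fderiv ℝ ρ p v = 0 → fderiv ℝ ρ p (J v) = 0 → α p v = 0 :=
    h.self_of_nhds hp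
  -- Differentiate `hrel` along the level set; the derivatives of `A`, `B`, `C` drop out because
  -- their cofactors vanish on complex tangents.
  have hder : ∀ u v, fderiv ℝ ρ p u = 0 → fderiv ℝ ρ p v = 0 → fderiv ℝ ρ p (J v) = 0 →
      A p * fderiv ℝ α p u v - B p * fderiv ℝ (fderiv ℝ ρ) p u v
        - C p * fderiv ℝ (fderiv ℝ ρ) p u (J v) = 0 := by
    intro u v hu hv hJv
    have hg : ContDiffAt ℝ 1 (fun q => A q * α q v - B q * fderiv ℝ ρ q v
        - C q * fderiv ℝ ρ q (J v)) p :=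
      ((hA.mul (hev v hα)).sub (hB.mul (hev v hdρ))).sub (hC.mul (hev (J v) hdρ))
    have hgd := (((hd hA).mul (hdα.clm_apply_const v)).sub
      ((hd hB).mul (hddρ.clm_apply_const v))).sub ((hd hC).mul (hddρ.clm_apply_const (J v)))
    have := (hρ.hasStrictFDerivAt (by norm_num)).apply_eq_zero_of_eq_zero_on_level
      (hg.hasStrictFDerivAt' hgd one_ne_zero) hρ' hp (hrel.mono fun q hq hq0 => hq hq0 v) hu
    simpa [hv, hJv, hα0 v hv hJv] using this
  have hsymm : fderiv ℝ (fderiv ℝ ρ) p w (J w) = fderiv ℝ (fderiv ℝ ρ) p (J w) w :=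
    (hρ.isSymmSndFDerivAt (by simp)).eq w (J w)
  -- In the difference of the two instances the `B` terms cancel by symmetry of the Hessian, and the
  -- `C` terms add up to the Levi form.
  have e1 := hder w (J w) hw hJw (by rw [hJ, map_neg, hw, neg_zero])
  have e2 := hder (J w) w hJw hw hJw
  rw [hJ, map_neg] at e1
  field_simp
  rw [hsymm] at e1
  linarith

end LevelSets

/-! ### Wirtinger derivatives and the Levi form in real terms. -/

section Coordinates

variable {N : ℕ}

theorem apply_eq_sum_re_im (l : (Fin N → ℂ) →L[ℝ] ℝ) (w : Fin N → ℂ) :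
    l w = ∑ j, ((w j).re * l (Pi.single j 1) + (w j).im * l (Pi.single j Complex.I)) := by
  have hw : w = ∑ j, ((w j).re • (Pi.single j 1 : Fin N → ℂ)
      + (w j).im • (Pi.single j Complex.I : Fin N → ℂ)) := by
    ext k
    simp [Finset.sum_apply, Pi.single_apply, Finset.sum_add_distrib, Complex.re_add_im]
  conv_lhs => rw [hw]
  simp [map_sum, smul_eq_mul]

theorem apply_I_smul_eq_sum_re_im (l : (Fin N → ℂ) →L[ℝ] ℝ) (w : Fin N → ℂ) :
    l (Complex.I • w) =
      ∑ j, ((w j).re * l (Pi.single j Complex.I) - (w j).im * l (Pi.single j 1)) := by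
  rw [apply_eq_sum_re_im]
  refine Finset.sum_congr rfl fun j _ => ?_
  simp; ring

/-- The complex linear part of a real linear form, in coordinates. -/
theorem sum_sub_I_mul_apply_single (l : (Fin N → ℂ) →L[ℝ] ℝ) (w : Fin N → ℂ) :
    ∑ j, ((l (Pi.single j 1) : ℂ) - Complex.I * l (Pi.single j Complex.I)) * w j =
      l w - Complex.I * l (Complex.I • w) := by
  rw [apply_I_smul_eq_sum_re_im l w, apply_eq_sum_re_im l w]
  push_cast
  rw [Finset.mul_sum, ← Finset.sum_sub_distrib]
  refine Finset.sum_congr rfl fun j _ => ?_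
  apply Complex.ext <;> simp <;> ring

/-- The complex antilinear part of a real linear form, in coordinates. -/
theorem sum_add_I_mul_apply_single (l : (Fin N → ℂ) →L[ℝ] ℝ) (w : Fin N → ℂ) :
    ∑ j, ((l (Pi.single j 1) : ℂ) + Complex.I * l (Pi.single j Complex.I))
      * (starRingEnd ℂ) (w j) = l w + Complex.I * l (Complex.I • w) := by
  rw [apply_I_smul_eq_sum_re_im l w, apply_eq_sum_re_im l w]
  push_cast
  rw [Finset.mul_sum, ← Finset.sum_add_distrib]
  refine Finset.sum_congr rfl fun j _ => ?_
  apply Complex.ext <;> simp <;> ring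

theorem HasFDerivAt.wirtingerDeriv_eq {f : (Fin N → ℂ) → ℂ} {f' : (Fin N → ℂ) →L[ℝ] ℂ}
    {z : Fin N → ℂ} (hf : HasFDerivAt f f' z) (j : Fin N) :
    wirtingerDeriv j f z =
      (f' (Pi.single j 1) - Complex.I * f' (Pi.single j Complex.I)) / 2 := by
  rw [wirtingerDeriv, hf.fderiv]

theorem HasFDerivAt.wirtingerDerivBar_eq {f : (Fin N → ℂ) → ℂ} {f' : (Fin N → ℂ) →L[ℝ] ℂ}
    {z : Fin N → ℂ} (hf : HasFDerivAt f f' z) (j : Fin N) :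
    wirtingerDerivBar j f z =
      (f' (Pi.single j 1) + Complex.I * f' (Pi.single j Complex.I)) / 2 := by
  rw [wirtingerDerivBar, hf.fderiv]

theorem HasFDerivAt.ofReal_comp {E : Type*} [NormedAddCommGroup E] [NormedSpace ℝ E]
    {f : E → ℝ} {f' : E →L[ℝ] ℝ} {z : E} (hf : HasFDerivAt f f' z) :
    HasFDerivAt (fun z => (f z : ℂ)) (Complex.ofRealCLM.comp f') z :=
  Complex.ofRealCLM.hasFDerivAt.comp z hf

theorem sum_wirtingerDeriv_mul {ρ : (Fin N → ℂ) → ℝ} {p : Fin N → ℂ}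
    (hρ : DifferentiableAt ℝ ρ p) (w : Fin N → ℂ) :
    ∑ j, wirtingerDeriv j (fun z => (ρ z : ℂ)) p * w j =
      ((fderiv ℝ ρ p w : ℂ) - Complex.I * fderiv ℝ ρ p (Complex.I • w)) / 2 := by
  rw [← sum_sub_I_mul_apply_single, Finset.sum_div]
  refine Finset.sum_congr rfl fun j _ => ?_
  rw [hρ.hasFDerivAt.ofReal_comp.wirtingerDeriv_eq]
  simp; ring

/-- The Levi form in terms of the real Hessian. -/
theorem leviForm_eq {ρ : (Fin N → ℂ) → ℝ} {p : Fin N → ℂ} (hρ : ContDiffAt ℝ 2 ρ p)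
    (w : Fin N → ℂ) :
    leviForm ρ p w = (fderiv ℝ (fderiv ℝ ρ) p w w
      + fderiv ℝ (fderiv ℝ ρ) p (Complex.I • w) (Complex.I • w)) / 4 := by
  set B := fderiv ℝ (fderiv ℝ ρ) p with hB
  have hBd : HasFDerivAt (fderiv ℝ ρ) B p :=
    ((hρ.fderiv_right (m := 1) (by norm_num)).differentiableAt one_ne_zero).hasFDerivAt
  have hbar : ∀ k, wirtingerDerivBar k (fun z => (ρ z : ℂ)) =ᶠ[𝓝 p] fun z =>
      ((fderiv ℝ ρ z (Pi.single k 1) : ℂ)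
        + Complex.I * fderiv ℝ ρ z (Pi.single k Complex.I)) * (1 / 2) := by
    intro k
    filter_upwards [hρ.eventually (by simp)] with z hz
    rw [(hz.differentiableAt two_ne_zero).hasFDerivAt.ofReal_comp.wirtingerDerivBar_eq]
    simp; ring
  have hder : ∀ j k, wirtingerDeriv j (wirtingerDerivBar k fun z => (ρ z : ℂ)) p =
      (((B (Pi.single j 1) (Pi.single k 1) : ℂ)
          + Complex.I * B (Pi.single j 1) (Pi.single k Complex.I))
        - Complex.I * ((B (Pi.single j Complex.I) (Pi.single k 1) : ℂ)
          + Complex.I * B (Pi.single j Complex.I) (Pi.single k Complex.I))) / 4 := by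
    intro j k
    have h1 := ((hBd.clm_apply_const (Pi.single k (1 : ℂ))).ofReal_comp.add
      ((hBd.clm_apply_const (Pi.single k Complex.I)).ofReal_comp.const_mul
        Complex.I)).mul_const (1 / 2 : ℂ)
    rw [(h1.congr_of_eventuallyEq (hbar k)).wirtingerDeriv_eq]
    simp; ring
  have hsum : ∑ j, ∑ k, wirtingerDeriv j (wirtingerDerivBar k fun z => (ρ z : ℂ)) p
      * w j * (starRingEnd ℂ) (w k) =
      ((B w w - Complex.I * B (Complex.I • w) w)
        + Complex.I * (B w (Complex.I • w)
          - Complex.I * B (Complex.I • w) (Complex.I • w))) / 4 := by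
    -- The sum over k is the antilinear part of `B` in its second slot; the sum over j is then the
    -- linear part in the first.
    have hin : ∀ j, ∑ k, wirtingerDeriv j (wirtingerDerivBar k fun z => (ρ z : ℂ)) p
        * w j * (starRingEnd ℂ) (w k) =
        ((((B.flip w (Pi.single j 1) : ℂ) - Complex.I * B.flip w (Pi.single j Complex.I)) * w j)
          + Complex.I * (((B.flip (Complex.I • w) (Pi.single j 1) : ℂ)
            - Complex.I * B.flip (Complex.I • w) (Pi.single j Complex.I)) * w j)) / 4 := by
      intro j
      have e1 := sum_add_I_mul_apply_single (B (Pi.single j 1)) w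
      have e2 := sum_add_I_mul_apply_single (B (Pi.single j Complex.I)) w
      calc _ = ((∑ k, ((B (Pi.single j 1) (Pi.single k 1) : ℂ)
              + Complex.I * B (Pi.single j 1) (Pi.single k Complex.I)) * (starRingEnd ℂ) (w k))
            - Complex.I * ∑ k, ((B (Pi.single j Complex.I) (Pi.single k 1) : ℂ)
              + Complex.I * B (Pi.single j Complex.I) (Pi.single k Complex.I))
                * (starRingEnd ℂ) (w k)) * w j / 4 := by
            rw [Finset.mul_sum, ← Finset.sum_sub_distrib, Finset.sum_mul, Finset.sum_div]
            refine Finset.sum_congr rfl fun k _ => ?_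
            rw [hder]; ring
        _ = _ := by
            rw [e1, e2]
            simp only [ContinuousLinearMap.flip_apply]
            ring
    rw [Finset.sum_congr rfl fun j _ => hin j, ← Finset.sum_div, Finset.sum_add_distrib,
      ← Finset.mul_sum, sum_sub_I_mul_apply_single, sum_sub_I_mul_apply_single]
    simp only [ContinuousLinearMap.flip_apply]
  rw [leviForm, hsum]
  have : (4 : ℂ) = ((4 : ℝ) : ℂ) := by norm_num
  rw [this, Complex.div_ofReal_re]
  simp

end Coordinates

/-! ### Tangent spaces and CR bundles. -/

section Tangent

variable {N N' : ℕ}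

theorem IsDefiningFunctionOn.contDiffAt {M U : Set (Fin N → ℂ)} {ρ : (Fin N → ℂ) → ℝ}
    (h : IsDefiningFunctionOn M U ρ) {q : Fin N → ℂ} (hq : q ∈ U) {n : ℕ} :
    ContDiffAt ℝ n ρ q :=
  (h.contDiffOn.contDiffAt (h.isOpen.mem_nhds hq)).of_le (by exact_mod_cast le_top)

theorem IsDefiningFunctionOn.hasStrictFDerivAt {M U : Set (Fin N → ℂ)} {ρ : (Fin N → ℂ) → ℝ}
    (h : IsDefiningFunctionOn M U ρ) {q : Fin N → ℂ} (hq : q ∈ U) :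
    HasStrictFDerivAt ρ (fderiv ℝ ρ q) q :=
  (h.contDiffAt hq (n := 1)).hasStrictFDerivAt (by norm_num)

theorem IsDefiningFunctionOn.eventually_mem_iff {M U : Set (Fin N → ℂ)} {ρ : (Fin N → ℂ) → ℝ}
    (h : IsDefiningFunctionOn M U ρ) {q : Fin N → ℂ} (hq : q ∈ U) :
    ∀ᶠ z in 𝓝 q, z ∈ M ↔ ρ z = 0 :=
  (h.isOpen.eventually_mem hq).mono h.mem_iff

/-- Any other defining function vanishes on the level set of `ρ`, so its differential vanishes on
the kernel of dρ: one defining function suffices. -/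
theorem IsDefiningFunctionOn.mem_realTangentSpace_iff {M U : Set (Fin N → ℂ)}
    {ρ : (Fin N → ℂ) → ℝ} (h : IsDefiningFunctionOn M U ρ) {q : Fin N → ℂ} (hq : q ∈ U)
    (hqM : q ∈ M) {v : Fin N → ℂ} : v ∈ realTangentSpace M q ↔ fderiv ℝ ρ q v = 0 := by
  refine ⟨fun hv => hv U ρ hq h, fun hv V σ hqV hσ => ?_⟩
  refine (h.hasStrictFDerivAt hq).apply_eq_zero_of_eq_zero_on_level (hσ.hasStrictFDerivAt hqV)
    (h.fderiv_ne_zero q hq hqM) ((h.mem_iff q hq).1 hqM) ?_ hv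
  filter_upwards [h.eventually_mem_iff hq, hσ.eventually_mem_iff hqV] with z h1 h2 h3
  exact h2.1 (h1.2 h3)

theorem apply_eq_zero_of_mem_baseChange {V : Type*} [AddCommGroup V] [Module ℝ V]
    {S : Submodule ℝ V} {l : V →ₗ[ℝ] ℝ} (hl : ∀ x ∈ S, l x = 0) {a b : V}
    (h : (1 : ℂ) ⊗ₜ[ℝ] a + Complex.I ⊗ₜ[ℝ] b ∈ S.baseChange ℂ) : l a = 0 ∧ l b = 0 := by
  have hle : S.baseChange ℂ ≤ LinearMap.ker (l.baseChange ℂ) := by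
    rw [Submodule.baseChange_eq_span, Submodule.span_le]
    rintro _ ⟨x, hx, rfl⟩
    simp [hl x hx]
  have h0 : l.baseChange ℂ ((1 : ℂ) ⊗ₜ[ℝ] a + Complex.I ⊗ₜ[ℝ] b) = 0 := hle h
  have h1 := congrArg (TensorProduct.rid ℝ ℂ) h0
  simp only [map_add, LinearMap.baseChange_tmul, TensorProduct.rid_tmul, map_zero] at h1
  exact ⟨by simpa using congrArg Complex.re h1, by simpa using congrArg Complex.im h1⟩

theorem tmul_add_I_tmul_mem_eigenspace (a : Fin N → ℂ) :
    (1 : ℂ) ⊗ₜ[ℝ] a + Complex.I ⊗ₜ[ℝ] (Complex.I • a) ∈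
      Module.End.eigenspace ((complexStructure N).baseChange ℂ) (-Complex.I) := by
  have hJ : ∀ x, complexStructure N x = Complex.I • x := fun _ => rfl
  rw [Module.End.mem_eigenspace_iff]
  simp only [map_add, LinearMap.baseChange_tmul, hJ, smul_add, TensorProduct.smul_tmul',
    smul_eq_mul, smul_smul, Complex.I_mul_I, mul_one, neg_neg, neg_smul, one_smul,
    TensorProduct.tmul_neg, TensorProduct.neg_tmul]
  abel

theorem eq_I_smul_of_mem_eigenspace {a b : Fin N → ℂ}
    (h : (1 : ℂ) ⊗ₜ[ℝ] a + Complex.I ⊗ₜ[ℝ] b ∈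
      Module.End.eigenspace ((complexStructure N).baseChange ℂ) (-Complex.I)) :
    b = Complex.I • a := by
  have hJ : ∀ x, complexStructure N x = Complex.I • x := fun _ => rfl
  rw [Module.End.mem_eigenspace_iff] at h
  -- Take real parts, z ⊗ x ↦ (Re z) x: the two sides become Ja and b.
  have h1 := congrArg (TensorProduct.lift ((LinearMap.lsmul ℝ (Fin N → ℂ)).comp
    Complex.reLm : ℂ →ₗ[ℝ] (Fin N → ℂ) →ₗ[ℝ] (Fin N → ℂ))) h
  simpa [hJ, smul_add, TensorProduct.smul_tmul', eq_comm] using h1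

/-- A real linear map respecting the CR bundles is complex linear on complex tangent spaces and
maps them to complex tangent spaces. -/
theorem apply_of_map_crBundle_le {M : Set (Fin N → ℂ)} {M' : Set (Fin N' → ℂ)} {p : Fin N → ℂ}
    {q : Fin N' → ℂ} {L : (Fin N → ℂ) →L[ℝ] (Fin N' → ℂ)}
    (h : (crBundle M p).map (L.toLinearMap.baseChange ℂ) ≤ crBundle M' q) {v : Fin N → ℂ}
    (hv : v ∈ realTangentSpace M p) (hJv : Complex.I • v ∈ realTangentSpace M p) :
    L (Complex.I • v) = Complex.I • L v ∧ ∀ U' ρ', q ∈ U' → IsDefiningFunctionOn M' U' ρ' →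
      fderiv ℝ ρ' q (L v) = 0 ∧ fderiv ℝ ρ' q (Complex.I • L v) = 0 := by
  have hmem : (1 : ℂ) ⊗ₜ[ℝ] v + Complex.I ⊗ₜ[ℝ] (Complex.I • v) ∈ crBundle M p :=
    ⟨add_mem (Submodule.tmul_mem_baseChange_of_mem _ hv)
      (Submodule.tmul_mem_baseChange_of_mem _ hJv), tmul_add_I_tmul_mem_eigenspace v⟩
  have himg := h (Submodule.mem_map_of_mem hmem)
  simp only [map_add, LinearMap.baseChange_tmul, ContinuousLinearMap.coe_coe] at himg
  have hI := eq_I_smul_of_mem_eigenspace himg.2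
  refine ⟨hI, fun U' ρ' hq hρ' => ?_⟩
  have := apply_eq_zero_of_mem_baseChange (S := realTangentSpace M' q)
    (l := (fderiv ℝ ρ' q).toLinearMap)
    (fun x hx => hx U' ρ' hq hρ') himg.1
  rwa [hI] at this

end Tangent

/-! ### Differentials of CR maps. -/

section CRMaps

variable {N N' : ℕ}

/-- `Φ` is a `C^2` map on the open set `U` which extends `F` there. -/
structure IsLocalExtension {M : Set (Fin N → ℂ)} {M' : Set (Fin N' → ℂ)} (F : M → M')
    (U : Set (Fin N → ℂ)) (Φ : (Fin N → ℂ) → (Fin N' → ℂ)) : Prop where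
  isOpen : IsOpen U
  contDiffOn : ContDiffOn ℝ 2 Φ U
  eq : ∀ q : M, (q : Fin N → ℂ) ∈ U → Φ q = F q

theorem IsLocalExtension.contDiffAt {M : Set (Fin N → ℂ)} {M' : Set (Fin N' → ℂ)} {F : M → M'}
    {U : Set (Fin N → ℂ)} {Φ : (Fin N → ℂ) → (Fin N' → ℂ)} (h : IsLocalExtension F U Φ)
    {q : Fin N → ℂ} (hq : q ∈ U) : ContDiffAt ℝ 2 Φ q :=
  h.contDiffOn.contDiffAt (h.isOpen.mem_nhds hq)

/-- The differentials of two extensions of `F` agree on the tangent space of `M`. -/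
theorem IsLocalExtension.fderiv_apply_eq {M : Set (Fin N → ℂ)} {M' : Set (Fin N' → ℂ)}
    (hM : IsSmoothRealHypersurface M) {F : M → M'} {U V : Set (Fin N → ℂ)}
    {Φ Ψ : (Fin N → ℂ) → (Fin N' → ℂ)} (hΦ : IsLocalExtension F U Φ)
    (hΨ : IsLocalExtension F V Ψ) {q : Fin N → ℂ} (hqM : q ∈ M) (hqU : q ∈ U) (hqV : q ∈ V)
    {v : Fin N → ℂ} (hv : v ∈ realTangentSpace M q) : fderiv ℝ Φ q v = fderiv ℝ Ψ q v := by
  obtain ⟨W, ρ, hqW, hρ⟩ := hM q hqM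
  have hd := ((hΦ.contDiffAt hqU).hasStrictFDerivAt two_ne_zero).sub
    ((hΨ.contDiffAt hqV).hasStrictFDerivAt two_ne_zero)
  have := (hρ.hasStrictFDerivAt hqW).apply_eq_zero_of_eq_zero_on_level hd
    (hρ.fderiv_ne_zero q hqW hqM) ((hρ.mem_iff q hqW).1 hqM) (by
      filter_upwards [hρ.eventually_mem_iff hqW, hΦ.isOpen.eventually_mem hqU,
        hΨ.isOpen.eventually_mem hqV] with z h1 h2 h3 h4
      simp [hΦ.eq ⟨z, h1.2 h4⟩ h2, hΨ.eq ⟨z, h1.2 h4⟩ h3]) (hv W ρ hqW hρ)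
  simpa [sub_eq_zero] using this

/-- The differential of any extension of a CR map is complex linear on the complex tangent spaces of
`M` and maps them to complex tangent spaces of `M'`. -/
theorem IsLocalExtension.fderiv_apply_of_isCRMap {M : Set (Fin N → ℂ)} {M' : Set (Fin N' → ℂ)}
    (hM : IsSmoothRealHypersurface M) {F : M → M'} (hF : IsCRMapOfClass 2 F)
    {U : Set (Fin N → ℂ)} {Φ : (Fin N → ℂ) → (Fin N' → ℂ)} (hΦ : IsLocalExtension F U Φ)
    {q : Fin N → ℂ} (hqM : q ∈ M) (hqU : q ∈ U) {v : Fin N → ℂ}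
    (hv : v ∈ realTangentSpace M q) (hJv : Complex.I • v ∈ realTangentSpace M q) :
    fderiv ℝ Φ q (Complex.I • v) = Complex.I • fderiv ℝ Φ q v ∧
      ∀ U' ρ', Φ q ∈ U' → IsDefiningFunctionOn M' U' ρ' →
        fderiv ℝ ρ' (Φ q) (fderiv ℝ Φ q v) = 0 ∧
        fderiv ℝ ρ' (Φ q) (Complex.I • fderiv ℝ Φ q v) = 0 := by
  -- The CR condition at `q` is known only for the extension chosen at `q`; it passes to `Φ` because
  -- the two differentials agree on tangent vectors.
  obtain ⟨V, Ψ, hV, hqV, hΨc, hΨ, hcr⟩ := hF ⟨q, hqM⟩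
  have hΨ' : IsLocalExtension F V Ψ := ⟨hV, hΨc, hΨ⟩
  rw [hΦ.fderiv_apply_eq hM hΨ' hqM hqU hqV hv, hΦ.fderiv_apply_eq hM hΨ' hqM hqU hqV hJv,
    hΦ.eq ⟨q, hqM⟩ hqU]
  exact apply_of_map_crBundle_le hcr hv hJv

/-- A dimension count from a space of real codimension 2 to another such space. The summands x n + y
Jn, transverse to the target, make it a comparison of 2N + 2 with 2N' + 2; the hypothesis on `L`
forces x = y = 0 on the kernel of `T`. -/
theorem exists_ne_zero_mem_complex_tangent_apply_eq_zero (hlt : N' < N)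
    (L : (Fin N → ℂ) →L[ℝ] (Fin N' → ℂ)) (l : (Fin N → ℂ) →L[ℝ] ℝ)
    {l' : (Fin N' → ℂ) →L[ℝ] ℝ} (hl' : l' ≠ 0)
    (h : ∀ w, l w = 0 → l (Complex.I • w) = 0 → l' (L w) = 0 ∧ l' (Complex.I • L w) = 0) :
    ∃ w, w ≠ 0 ∧ l w = 0 ∧ l (Complex.I • w) = 0 ∧ L w = 0 := by
  obtain ⟨n, hn⟩ : ∃ m, l' m ≠ 0 := by
    by_contra! hcon
    exact hl' (ContinuousLinearMap.ext hcon)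
  let T : ((Fin N → ℂ) × ℝ × ℝ) →ₗ[ℝ] ((Fin N' → ℂ) × ℝ × ℝ) :=
    { toFun x := (L x.1 + x.2.1 • n + x.2.2 • (Complex.I • n), l x.1, l (Complex.I • x.1))
      map_add' x y := by
        ext <;> simp [add_smul, smul_add] <;> ring
      map_smul' c x := by
        have : Complex.I • c • x.1 = c • Complex.I • x.1 := smul_comm _ _ _
        ext <;> simp [smul_add, this] <;> ring }
  have hker : LinearMap.ker T ≠ ⊥ := by
    apply LinearMap.ker_ne_bot_of_finrank_lt
    simp [Module.finrank_prod, Module.finrank_pi_fintype, Complex.finrank_real_complex]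
    omega
  obtain ⟨⟨w, x, y⟩, hT, hne⟩ := Submodule.exists_mem_ne_zero_of_ne_bot hker
  have hT' : (L w + x • n + y • (Complex.I • n), l w, l (Complex.I • w)) = 0 := hT
  obtain ⟨h1, h2, h3⟩ : L w + x • n + y • (Complex.I • n) = 0 ∧ l w = 0 ∧
      l (Complex.I • w) = 0 := by simpa [Prod.ext_iff] using hT'
  obtain ⟨h4, h5⟩ := h w h2 h3
  have e1 := congrArg l' h1
  have e2 := congrArg (fun z => l' (Complex.I • z)) h1
  have hxI : Complex.I • x • n = x • Complex.I • n := smul_comm _ _ _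
  have hyI : Complex.I • y • Complex.I • n = -(y • n) := by
    rw [smul_comm Complex.I y, smul_smul, Complex.I_mul_I]; simp
  simp only [map_add, map_smul, h4, smul_eq_mul, map_zero, zero_add] at e1
  simp only [smul_add, hxI, hyI, map_add, map_smul, map_neg, h5, smul_eq_mul, smul_zero, map_zero,
    zero_add] at e2
  have hpos : 0 < l' n * l' n := mul_self_pos.2 hn
  have hD : l' n * l' n + l' (Complex.I • n) * l' (Complex.I • n) ≠ 0 := by
    have := mul_self_nonneg (l' (Complex.I • n))
    linarith
  have hx : x = 0 := by
    refine (mul_eq_zero.1 (?_ : x * _ = 0)).resolve_right hD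
    linear_combination l' n * e1 + l' (Complex.I • n) * e2
  have hy : y = 0 := by
    refine (mul_eq_zero.1 (?_ : y * _ = 0)).resolve_right hD
    linear_combination l' (Complex.I • n) * e1 - l' n * e2
  subst hx hy
  refine ⟨w, fun hw => hne (by simp [hw]), h2, h3, by simpa using h1⟩

theorem exists_ne_zero_mem_complex_tangent (hN : 2 ≤ N) (l : (Fin N → ℂ) →L[ℝ] ℝ) :
    ∃ w, w ≠ 0 ∧ l w = 0 ∧ l (Complex.I • w) = 0 := by
  -- With the zero map into ℂ¹, the condition N' < N is exactly 2 ≤ N.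
  obtain ⟨w, hw, h1, h2, -⟩ := exists_ne_zero_mem_complex_tangent_apply_eq_zero
    (N' := 1) hN 0 l (l' := Complex.reCLM.comp (ContinuousLinearMap.proj 0))
    (fun h => by simpa using DFunLike.congr_fun h 1) (by simp)
  exact ⟨w, hw, h1, h2⟩

/-- Strong pseudoconvexity in terms of the real Hessian. -/
theorem IsStronglyPseudoconvexHypersurface.exists_hessian_pos {M : Set (Fin N → ℂ)}
    (hM : IsStronglyPseudoconvexHypersurface M) {p : Fin N → ℂ} (hp : p ∈ M) :
    ∃ U ρ, p ∈ U ∧ IsDefiningFunctionOn M U ρ ∧ ∀ w, w ≠ 0 → fderiv ℝ ρ p w = 0 →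
      fderiv ℝ ρ p (Complex.I • w) = 0 → 0 < fderiv ℝ (fderiv ℝ ρ) p w w
        + fderiv ℝ (fderiv ℝ ρ) p (Complex.I • w) (Complex.I • w) := by
  obtain ⟨U, ρ, hpU, hρ, hpos⟩ := hM.2 p hp
  refine ⟨U, ρ, hpU, hρ, fun w hw h1 h2 => ?_⟩
  have := hpos w hw (by
    rw [sum_wirtingerDeriv_mul (hρ.hasStrictFDerivAt hpU).differentiableAt, h1, h2]; simp)
  rw [leviForm_eq (hρ.contDiffAt hpU)] at this
  linarith

/-- Multiplication by `i` as a continuous real linear map. -/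
noncomputable def mulICLM (N : ℕ) : (Fin N → ℂ) →L[ℝ] (Fin N → ℂ) :=
  LinearMap.toContinuousLinearMap (complexStructure N)

theorem mulICLM_apply (v : Fin N → ℂ) : mulICLM N v = Complex.I • v := rfl

theorem mulICLM_mulICLM (v : Fin N → ℂ) : mulICLM N (mulICLM N v) = -v := by
  rw [mulICLM_apply, mulICLM_apply, smul_smul, Complex.I_mul_I, neg_one_smul]

/-- The differential of a CR map to a strongly pseudoconvex hypersurface in a space of lower
dimension vanishes on the complex tangent spaces. -/
theorem IsLocalExtension.fderiv_apply_eq_zero_of_mem_complex_tangent (hlt : N' < N)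
    {M : Set (Fin N → ℂ)} {M' : Set (Fin N' → ℂ)} (hM : IsStronglyPseudoconvexHypersurface M)
    (hM' : IsStronglyPseudoconvexHypersurface M') {F : M → M'} (hF : IsCRMapOfClass 2 F)
    {U : Set (Fin N → ℂ)} {Φ : (Fin N → ℂ) → (Fin N' → ℂ)} (hΦ : IsLocalExtension F U Φ)
    {p : Fin N → ℂ} (hpM : p ∈ M) (hpU : p ∈ U) {v : Fin N → ℂ}
    (hv : v ∈ realTangentSpace M p) (hJv : Complex.I • v ∈ realTangentSpace M p) :
    fderiv ℝ Φ p v = 0 := by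
  obtain ⟨V, ρ, hpV, hρ, hpos⟩ := hM.exists_hessian_pos hpM
  have hpM' : Φ p ∈ M' := by rw [hΦ.eq ⟨p, hpM⟩ hpU]; exact (F ⟨p, hpM⟩).2
  obtain ⟨V', ρ', hpV', hρ', hpos'⟩ := hM'.exists_hessian_pos hpM'
  have hΦp := hΦ.contDiffAt hpU
  have hcr : ∀ q, q ∈ U → q ∈ M → q ∈ V → Φ q ∈ V' → ∀ w, fderiv ℝ ρ q w = 0 →
      fderiv ℝ ρ q (Complex.I • w) = 0 →
      fderiv ℝ Φ q (Complex.I • w) = Complex.I • fderiv ℝ Φ q w ∧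
        fderiv ℝ ρ' (Φ q) (fderiv ℝ Φ q w) = 0 ∧
        fderiv ℝ ρ' (Φ q) (Complex.I • fderiv ℝ Φ q w) = 0 := by
    intro q hqU hqM hqV hqV' w h1 h2
    obtain ⟨h3, h4⟩ := hΦ.fderiv_apply_of_isCRMap hM.1 hF hqM hqU
      ((hρ.mem_realTangentSpace_iff hqV hqM).2 h1) ((hρ.mem_realTangentSpace_iff hqV hqM).2 h2)
    exact ⟨h3, h4 V' ρ' hqV' hρ'⟩
  -- the pullback of the contact form of `M'`
  let α : (Fin N → ℂ) → (Fin N → ℂ) →L[ℝ] ℝ := fun q =>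
    ((fderiv ℝ ρ' (Φ q)).comp (mulICLM N')).comp (fderiv ℝ Φ q)
  have hdΦ : ContDiffAt ℝ 1 (fderiv ℝ Φ) p := hΦp.fderiv_right (by norm_num)
  have hdρ' : ContDiffAt ℝ 1 (fderiv ℝ ρ') (Φ p) :=
    (hρ'.contDiffAt hpV' (n := 2)).fderiv_right (by norm_num)
  have hα : ContDiffAt ℝ 1 α p :=
    ((hdρ'.comp p (hΦp.of_le (by norm_num))).clm_comp contDiffAt_const).clm_comp hdΦ
  have hαd : ∀ u w, fderiv ℝ α p u w =
      fderiv ℝ (fderiv ℝ ρ') (Φ p) (fderiv ℝ Φ p u) (Complex.I • fderiv ℝ Φ p w)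
        + fderiv ℝ ρ' (Φ p) (Complex.I • fderiv ℝ (fderiv ℝ Φ) p u w) := by
    intro u w
    have h1 : HasFDerivAt (fun q => fderiv ℝ ρ' (Φ q))
        ((fderiv ℝ (fderiv ℝ ρ') (Φ p)).comp (fderiv ℝ Φ p)) p :=
      (hdρ'.differentiableAt one_ne_zero).hasFDerivAt.comp p
        (hΦp.differentiableAt two_ne_zero).hasFDerivAt
    have h2 := (h1.clm_comp (hasFDerivAt_const (mulICLM N') p)).clm_comp
      (hdΦ.differentiableAt one_ne_zero).hasFDerivAt
    have h3 : fderiv ℝ α p = _ := h2.fderiv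
    rw [h3]
    simp [mulICLM_apply, add_comm]
  obtain ⟨μ, ν, -, hμ⟩ := exists_multiplier_of_vanishing_on_complex_tangent
    (mulICLM_mulICLM (N := N)) (hρ.contDiffAt hpV) hα (hρ.fderiv_ne_zero p hpV hpM)
    ((hρ.mem_iff p hpV).1 hpM) (by
      filter_upwards [hρ.eventually_mem_iff hpV, hρ.isOpen.eventually_mem hpV,
        hΦ.isOpen.eventually_mem hpU,
        hΦp.continuousAt.eventually (hρ'.isOpen.eventually_mem hpV')] with q h1 h2 h3 h4 h5 w h6 h7
      exact (hcr q h3 (h1.2 h5) h2 h4 w h6 h7).2.2)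
  have hlevi : ∀ w, fderiv ℝ ρ p w = 0 → fderiv ℝ ρ p (Complex.I • w) = 0 →
      fderiv ℝ (fderiv ℝ ρ') (Φ p) (fderiv ℝ Φ p w) (fderiv ℝ Φ p w)
        + fderiv ℝ (fderiv ℝ ρ') (Φ p) (Complex.I • fderiv ℝ Φ p w)
          (Complex.I • fderiv ℝ Φ p w) =
      μ * (fderiv ℝ (fderiv ℝ ρ) p w w
        + fderiv ℝ (fderiv ℝ ρ) p (Complex.I • w) (Complex.I • w)) := by
    intro w h1 h2
    have h3 := hμ w h1 h2
    -- The second derivatives of `Φ` cancel by symmetry, leaving only the Hessian of `ρ'`; complex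
    -- linearity of dΦ at `w` turns it into the Levi form.
    rw [hαd, hαd, (hΦp.isSymmSndFDerivAt (by simp)).eq w] at h3
    simp only [mulICLM_apply, (hcr p hpU hpM hpV hpV' w h1 h2).1, smul_smul, Complex.I_mul_I,
      neg_one_smul, map_neg] at h3
    linarith
  obtain ⟨w, hw, hw1, hw2, hw3⟩ := exists_ne_zero_mem_complex_tangent_apply_eq_zero hlt
    (fderiv ℝ Φ p) (fderiv ℝ ρ p) (hρ'.fderiv_ne_zero _ hpV' hpM')
    (fun w h1 h2 => (hcr p hpU hpM hpV hpV' w h1 h2).2)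
  have hμ0 : μ = 0 := by
    have h1 := hlevi w hw1 hw2
    simp only [hw3, smul_zero, map_zero, add_zero] at h1
    exact (mul_eq_zero.1 h1.symm).resolve_right (hpos w hw hw1 hw2).ne'
  have hv1 := (hρ.mem_realTangentSpace_iff hpV hpM).1 hv
  have hv2 := (hρ.mem_realTangentSpace_iff hpV hpM).1 hJv
  by_contra hne
  obtain ⟨-, h4, h5⟩ := hcr p hpU hpM hpV hpV' v hv1 hv2
  have h6 := hpos' _ hne h4 h5
  rw [hlevi v hv1 hv2, hμ0, zero_mul] at h6
  exact lt_irrefl _ h6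

/-- A `C^2` map on a strongly pseudoconvex hypersurface whose differential vanishes on the complex
tangent spaces has vanishing differential. -/
theorem IsLocalExtension.fderiv_apply_eq_zero (hN : 2 ≤ N)
    {M : Set (Fin N → ℂ)} {M' : Set (Fin N' → ℂ)} (hM : IsStronglyPseudoconvexHypersurface M)
    {F : M → M'} {U : Set (Fin N → ℂ)} {Φ : (Fin N → ℂ) → (Fin N' → ℂ)}
    (hΦ : IsLocalExtension F U Φ)
    (h : ∀ q ∈ U, q ∈ M → ∀ v ∈ realTangentSpace M q, Complex.I • v ∈ realTangentSpace M q →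
      fderiv ℝ Φ q v = 0)
    {p : Fin N → ℂ} (hpM : p ∈ M) (hpU : p ∈ U) {v : Fin N → ℂ}
    (hv : v ∈ realTangentSpace M p) : fderiv ℝ Φ p v = 0 := by
  obtain ⟨V, ρ, hpV, hρ, hpos⟩ := hM.exists_hessian_pos hpM
  refine SeparatingDual.eq_zero_of_forall_dual_eq_zero (R := ℝ) fun l => ?_
  have hΦp := hΦ.contDiffAt hpU
  have hdΦ : ContDiffAt ℝ 1 (fderiv ℝ Φ) p := hΦp.fderiv_right (by norm_num)
  let α : (Fin N → ℂ) → (Fin N → ℂ) →L[ℝ] ℝ := fun q => l.comp (fderiv ℝ Φ q)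
  have hα : ContDiffAt ℝ 1 α p := contDiffAt_const.clm_comp hdΦ
  have hαd : ∀ u w, fderiv ℝ α p u w = l (fderiv ℝ (fderiv ℝ Φ) p u w) := by
    intro u w
    have h1 := (hasFDerivAt_const l p).clm_comp (hdΦ.differentiableAt one_ne_zero).hasFDerivAt
    have h2 : fderiv ℝ α p = _ := h1.fderiv
    rw [h2]
    simp
  obtain ⟨μ, ν, hμν, hμ⟩ := exists_multiplier_of_vanishing_on_complex_tangent
    (mulICLM_mulICLM (N := N)) (hρ.contDiffAt hpV) hα (hρ.fderiv_ne_zero p hpV hpM)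
    ((hρ.mem_iff p hpV).1 hpM) (by
      filter_upwards [hρ.eventually_mem_iff hpV, hρ.isOpen.eventually_mem hpV,
        hΦ.isOpen.eventually_mem hpU] with q h1 h2 h3 h5 w h6 h7
      have := h q h3 (h1.2 h5) w ((hρ.mem_realTangentSpace_iff h2 (h1.2 h5)).2 h6)
        ((hρ.mem_realTangentSpace_iff h2 (h1.2 h5)).2 h7)
      simp [α, this])
  obtain ⟨w, hw, hw1, hw2⟩ := exists_ne_zero_mem_complex_tangent hN (fderiv ℝ ρ p)
  have h3 := hμ w hw1 hw2
  -- `α` is the differential of `l ∘ Φ`, hence closed.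
  rw [hαd, hαd, (hΦp.isSymmSndFDerivAt (by simp)).eq w, sub_self] at h3
  have hμ0 : μ = 0 := by
    simpa using (mul_eq_zero.1 h3.symm).resolve_right (hpos w hw hw1 hw2).ne'
  have h4 := hμν v
  rw [hμ0, (hρ.mem_realTangentSpace_iff hpV hpM).1 hv] at h4
  simpa [α] using h4

end CRMaps

/-! ### From vanishing differential to constancy. -/

theorem theorem5p1 {N N' : ℕ} (hN : 2 ≤ N) (hN' : 2 ≤ N') (hlt : N' < N)
    (M : Set (Fin N → ℂ)) (M' : Set (Fin N' → ℂ))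
    (hM : IsStronglyPseudoconvexHypersurface M) (hM' : IsStronglyPseudoconvexHypersurface M')
    (hconn : IsPreconnected M)
    (F : M → M') (hF : IsCRMapOfClass 2 F) :
    ∀ p q : M, F p = F q := by
  have : PreconnectedSpace M := Subtype.preconnectedSpace hconn
  refine IsLocallyConstant.apply_eq_of_preconnectedSpace
    ((IsLocallyConstant.iff_eventually_eq F).2 fun p => ?_)
  obtain ⟨U, Φ, hU, hpU, hΦc, hΦF, -⟩ := hF p
  have hΦ : IsLocalExtension F U Φ := ⟨hU, hΦc, hΦF⟩
  obtain ⟨V, ρ, hpV, hρ⟩ := hM.1 p p.2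
  have hloc := eventually_eq_of_fderiv_eq_zero_on_level (hρ.contDiffAt hpV)
    ((hΦ.contDiffAt hpU).of_le (by norm_num)) (hρ.fderiv_ne_zero p hpV p.2)
    ((hρ.mem_iff p hpV).1 p.2) (by
      filter_upwards [hρ.isOpen.eventually_mem hpV, hU.eventually_mem hpU] with q hqV hqU hq0 v hv
      have hqM : q ∈ M := (hρ.mem_iff q hqV).2 hq0
      exact hΦ.fderiv_apply_eq_zero hN hM
        (fun z hzU hzM w hw hJw =>
          hΦ.fderiv_apply_eq_zero_of_mem_complex_tangent hlt hM hM' hF hzM hzU hw hJw)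
        hqM hqU ((hρ.mem_realTangentSpace_iff hqV hqM).2 hv))
  have hsub : Tendsto (Subtype.val : M → Fin N → ℂ) (𝓝 p) (𝓝 p) := continuousAt_subtype_val
  filter_upwards [hsub.eventually hloc, hsub.eventually (hU.eventually_mem hpU),
    hsub.eventually (hρ.isOpen.eventually_mem hpV)] with q h1 h2 h3
  have h4 := h1 ((hρ.mem_iff q h3).1 q.2)
  rw [hΦF q h2, hΦF p hpU] at h4
  exact Subtype.ext h4
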